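/- Let $n\ge 0$ be an integer and let $A,B,C$ be complex $n\times n$ matrices such that the $2n\times 2n$ matrix $\begin{pmatrix}A&B^*\\B&C\end{pmatrix}$ is Hermitian. Let $\|\cdot\|$ be a symmetric norm on the complex $2n\times 2n$ matrices, that is, a norm with $\|UXV\|=\|X\|$ for all $X$ and all unitary $U,V$. As usual, it is also evaluated on $n\times n$ matrices $X$ by $\|X\|:=\left\|\begin{pmatrix}X&0\\0&0\end{pmatrix}\right\|$, which is a symmetric norm there. Then, for every real $p$ with $0\le p\le 1$, $$\left\|\,\left|\begin{pmatrix}A&B^*\\B&C\end{pmatrix}\right|^p\,\right\|\le\left\|\,|A|^p+|B|^p+|B^*|^p+|C|^p\,\right\|,$$ where $|X|=(X^*X)^{1/2}$ and powers of positive semidefinite matrices are taken by functional calculus, with $|X|^0=I$. -/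

import Mathlib

open scoped Matrix MatrixOrder ComplexOrder

/-- A symmetric (unitarily invariant) norm on the space of complex square matrices indexed by `m`:
a norm with `‖U X V‖ = ‖X‖` for every matrix `X` and all unitary matrices `U`, `V`. -/
structure SymmetricNorm (m : Type*) [Fintype m] [DecidableEq m]
    extends Seminorm ℂ (Matrix m m ℂ) where
  eq_zero_of_map_eq_zero' : ∀ X : Matrix m m ℂ, toFun X = 0 → X = 0
  unitarily_invariant' : ∀ U ∈ Matrix.unitaryGroup m ℂ, ∀ V ∈ Matrix.unitaryGroup m ℂ,
    ∀ X : Matrix m m ℂ, toFun (U * X * V) = toFun X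

namespace SymmetricNorm

noncomputable instance instCoeFun {m : Type*} [Fintype m] [DecidableEq m] :
    CoeFun (SymmetricNorm m) (fun _ => Matrix m m ℂ → ℝ) :=
  ⟨fun N => N.toSeminorm⟩

/-- A symmetric norm on matrices of size `2n` evaluated on matrices of size `n`, through the usual
convention `‖X‖ = ‖X ⊕ 0‖`; it is again a symmetric norm. -/
noncomputable def corner {n : Type*} [Fintype n] [DecidableEq n] (N : SymmetricNorm (n ⊕ n)) :
    SymmetricNorm n where
  toSeminorm := Seminorm.of (fun X => N (Matrix.fromBlocks X 0 0 0))
    (fun X Y => by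
      have h := map_add_le_add N.toSeminorm (Matrix.fromBlocks X 0 0 0)
        (Matrix.fromBlocks Y 0 0 0)
      simpa [Matrix.fromBlocks_add] using h)
    (fun c X => by
      have h := map_smul_eq_mul N.toSeminorm c (Matrix.fromBlocks X 0 0 0)
      simpa [Matrix.fromBlocks_smul] using h)
  eq_zero_of_map_eq_zero' X h := by
    have h0 : Matrix.fromBlocks X (0 : Matrix n n ℂ) (0 : Matrix n n ℂ) (0 : Matrix n n ℂ) = 0 :=
      N.eq_zero_of_map_eq_zero' _ h
    rw [← Matrix.fromBlocks_zero] at h0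
    exact (Matrix.fromBlocks_inj.mp h0).1
  unitarily_invariant' U hU V hV X := by
    have hdiag : ∀ W ∈ Matrix.unitaryGroup n ℂ,
        Matrix.fromBlocks W 0 0 (1 : Matrix n n ℂ) ∈ Matrix.unitaryGroup (n ⊕ n) ℂ := by
      intro W hW
      rw [Matrix.mem_unitaryGroup_iff, Matrix.star_eq_conjTranspose] at hW ⊢
      simp [Matrix.fromBlocks_conjTranspose, Matrix.fromBlocks_multiply, hW]
    have h := N.unitarily_invariant' _ (hdiag U hU) _ (hdiag V hV) (Matrix.fromBlocks X 0 0 0)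
    simp only [Matrix.fromBlocks_multiply, Matrix.mul_zero, Matrix.zero_mul, add_zero,
      Matrix.mul_one] at h
    exact h

end SymmetricNorm

/-! Split the block matrix as `S + T`, with `S` its block-diagonal part and `T` its off-diagonal
part. Then `|S|^p` and `|T|^p` are the block-diagonal matrices `|A|^p ⊕ |C|^p` and `|B|^p ⊕ |B*|^p`.
Two facts suffice: `N (|S + T|^p) ≤ N (|S|^p + |T|^p)` for Hermitian `S`, `T`, and `‖X ⊕ Y‖ ≤ ‖X +
Y‖` for positive semidefinite `X`, `Y`.

For the first fact, `±(S + T) ≤ |S| + |T|`. Determinants of compressions then show that products of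
`k` numbers `|λ_i(S + T)|` are at most products of `k` eigenvalues of `|S| + |T|`
(`exists_prod_abs_eigenvalues_le`). For `p > 0` this gives weak majorization of the `p`-th powers
(`weakMaj_rpow_of_prod_le`). The Ando–Zhan inequality (`weakMaj_rpow_add`) passes from `(|S| +
|T|)^p` to `|S|^p + |T|^p`, and symmetric norms respect weak majorization (`diagSeminorm_mono`).
These steps need positive definite matrices, so `ε` is added to `|S|` and `|T|` and then sent to
zero.

The second fact is a pinching combined with the equality of the spectra of `R R*` and `R* R`. -/

section WeakMajorization

/-! ### Weak majorization of real families. -/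

variable {m : Type*}

/-- Weak majorization of real families: every sum of `k` terms of `a` is at most some sum of `k`
terms of `b`. -/
def WeakMaj (a b : m → ℝ) : Prop :=
  ∀ s : Finset m, ∃ t : Finset m, t.card = s.card ∧ ∑ i ∈ s, a i ≤ ∑ i ∈ t, b i

/-- `t` consists of indices of largest values of `b`. -/
def IsTopSet (b : m → ℝ) (t : Finset m) : Prop := ∀ i ∈ t, ∀ j ∉ t, b j ≤ b i

theorem WeakMaj.trans {a b c : m → ℝ} (h₁ : WeakMaj a b) (h₂ : WeakMaj b c) : WeakMaj a c := by
  intro s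
  obtain ⟨t, ht, h⟩ := h₁ s
  obtain ⟨u, hu, h'⟩ := h₂ t
  exact ⟨u, hu.trans ht, h.trans h'⟩

theorem WeakMaj.of_le_left {a b c : m → ℝ} (h₁ : ∀ i, a i ≤ b i) (h₂ : WeakMaj b c) :
    WeakMaj a c := by
  intro s
  obtain ⟨t, ht, h⟩ := h₂ s
  exact ⟨t, ht, (Finset.sum_le_sum fun i _ => h₁ i).trans h⟩

variable [Fintype m]

theorem exists_antitone_equiv (c : m → ℝ) :
    ∃ e : Fin (Fintype.card m) ≃ m, Antitone (c ∘ e) := by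
  let f := (Fintype.equivFin m).symm
  refine ⟨(Tuple.sort (fun i => -c (f i))).trans f, fun i j hij => ?_⟩
  have := Tuple.monotone_sort (fun i => -c (f i)) hij
  simpa using this

variable [DecidableEq m]

theorem exists_isTopSet (b : m → ℝ) {k : ℕ} (hk : k ≤ Fintype.card m) :
    ∃ t : Finset m, t.card = k ∧ IsTopSet b t := by
  induction k with
  | zero => exact ⟨∅, rfl, by simp [IsTopSet]⟩
  | succ k ih =>
    obtain ⟨t, ht, htop⟩ := ih (by omega)
    have hne : (tᶜ).Nonempty := by
      rw [← Finset.card_pos, Finset.card_compl]; omega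
    obtain ⟨x, hx, hmax⟩ := Finset.exists_max_image tᶜ b hne
    rw [Finset.mem_compl] at hx
    refine ⟨insert x t, by rw [Finset.card_insert_of_notMem hx, ht], ?_⟩
    intro i hi j hj
    rw [Finset.mem_insert, not_or] at hj
    rcases Finset.mem_insert.mp hi with rfl | hi
    · exact hmax j (Finset.mem_compl.mpr hj.2)
    · exact htop i hi j hj.2

/-- Bathtub principle: if `b x` is the least value on `t`, every term `(1_t i - e i) * (b i - b x)`
is nonnegative, and the threshold `b x` drops out because both weights have the same total. -/
theorem IsTopSet.sum_mul_le {b : m → ℝ} {t : Finset m} (ht : IsTopSet b t) {e : m → ℝ}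
    (he₀ : ∀ i, 0 ≤ e i) (he₁ : ∀ i, e i ≤ 1) (he : ∑ i, e i = t.card) :
    ∑ i, e i * b i ≤ ∑ i ∈ t, b i := by
  rcases t.eq_empty_or_nonempty with rfl | hne
  · simp only [Finset.card_empty, Nat.cast_zero] at he
    have h0 := (Finset.sum_eq_zero_iff_of_nonneg fun i _ => he₀ i).mp he
    rw [Finset.sum_eq_zero fun i hi => by rw [h0 i hi, zero_mul]]
    simp
  · obtain ⟨x, hx, hmin⟩ := Finset.exists_min_image t b hne
    have h1 : ∑ i ∈ t, b i = ∑ i, (if i ∈ t then 1 else 0) * b i := by simp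
    have h2 : ∑ i, (if i ∈ t then (1 : ℝ) else 0) = t.card := by simp
    have h3 : 0 ≤ ∑ i, ((if i ∈ t then (1 : ℝ) else 0) - e i) * (b i - b x) := by
      refine Finset.sum_nonneg fun i _ => ?_
      by_cases hi : i ∈ t
      · simp only [hi, if_true]
        exact mul_nonneg (by linarith [he₁ i]) (by linarith [hmin i hi])
      · simp only [hi, if_false]
        exact mul_nonneg_of_nonpos_of_nonpos (by linarith [he₀ i]) (by linarith [ht x hx i hi])
    simp only [sub_mul, mul_sub, Finset.sum_sub_distrib, ← Finset.sum_mul] at h3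
    rw [h1]
    rw [h2, he] at h3
    linarith

theorem IsTopSet.sum_le {b : m → ℝ} {t s : Finset m} (ht : IsTopSet b t) (hs : s.card = t.card) :
    ∑ i ∈ s, b i ≤ ∑ i ∈ t, b i := by
  have := ht.sum_mul_le (e := fun i => if i ∈ s then 1 else 0)
    (fun i => by split_ifs <;> norm_num) (fun i => by split_ifs <;> norm_num) (by simp [hs])
  simpa using this

/-- Abel summation. Partial sums matter only where `γ` is positive, since `γ` stays zero once it
vanishes; this slack later allows for logarithms of zero. -/
theorem sum_mul_nonneg_of_partial_sums {γ δ : ℕ → ℝ} {N : ℕ} (hγ : ∀ i, 0 ≤ γ i)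
    (hanti : ∀ i, i + 1 < N → γ (i + 1) ≤ γ i)
    (hδ : ∀ k < N, 0 < γ k → 0 ≤ ∑ i ∈ Finset.range (k + 1), δ i) :
    0 ≤ ∑ i ∈ Finset.range N, γ i * δ i := by
  have key : ∀ k, k < N → γ k * ∑ i ∈ Finset.range (k + 1), δ i ≤
      ∑ i ∈ Finset.range (k + 1), γ i * δ i := by
    intro k
    induction k with
    | zero => intro _; simp
    | succ k ih =>
      intro hk
      rw [Finset.sum_range_succ _ (k + 1), Finset.sum_range_succ _ (k + 1), mul_add]
      have h1 := ih (by omega)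
      have h2 : γ (k + 1) * ∑ i ∈ Finset.range (k + 1), δ i ≤
          γ k * ∑ i ∈ Finset.range (k + 1), δ i := by
        rcases (hγ k).eq_or_lt with h0 | h0
        · have : γ (k + 1) = 0 := le_antisymm (by rw [h0]; exact hanti k hk) (hγ _)
          rw [this, ← h0]
        · exact mul_le_mul_of_nonneg_right (hanti k hk) (hδ k (by omega) h0)
      linarith
  rcases N with _ | N
  · simp
  · refine le_trans ?_ (key N (by omega))
    rcases (hγ N).eq_or_lt with h0 | h0
    · rw [← h0, zero_mul]
    · exact mul_nonneg h0.le (hδ N (by omega) h0)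

/-- Rearrangement: `σ` pairs the largest `c` with the largest `b`, and Abel summation reduces the
claim to sums over the indices of the `k` largest `c`, where the top `k` values of `b` beat any `t`
given by `h`. -/
theorem exists_perm_sum_mul_le {a b c : m → ℝ} (hc : ∀ i, 0 ≤ c i)
    (h : ∀ s : Finset m, (∀ i ∈ s, 0 < c i) →
      ∃ t : Finset m, t.card = s.card ∧ ∑ i ∈ s, a i ≤ ∑ i ∈ t, b i) :
    ∃ σ : Equiv.Perm m, ∑ i, c i * a i ≤ ∑ i, c i * b (σ i) := by
  obtain ⟨e, he⟩ := exists_antitone_equiv c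
  obtain ⟨f, hf⟩ := exists_antitone_equiv b
  refine ⟨e.symm.trans f, ?_⟩
  let N := Fintype.card m
  let γ : ℕ → ℝ := fun i => if h : i < N then c (e ⟨i, h⟩) else 0
  let δ : ℕ → ℝ := fun i => if h : i < N then b (f ⟨i, h⟩) - a (e ⟨i, h⟩) else 0
  have hsum : ∑ i, c i * b ((e.symm.trans f) i) - ∑ i, c i * a i =
      ∑ i ∈ Finset.range N, γ i * δ i := by
    rw [← Fin.sum_univ_eq_sum_range (fun i => γ i * δ i), ← Finset.sum_sub_distrib,
      ← e.sum_comp]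
    refine Finset.sum_congr rfl fun i _ => ?_
    simp [γ, δ, mul_sub]
  rw [← sub_nonneg, hsum]
  refine sum_mul_nonneg_of_partial_sums (fun i => ?_) (fun i hi => ?_) (fun k hk hpos => ?_)
  · simp only [γ]; split_ifs <;> simp [hc]
  · simp only [γ, hi, show i < N by omega, dif_pos]
    exact he (Fin.mk_le_mk.mpr (by omega))
  · have hck : 0 < c (e ⟨k, hk⟩) := by simpa [γ, hk] using hpos
    let I : Finset (Fin N) := Finset.univ.filter fun i => i.val ≤ k
    have hcard : (I.map f.toEmbedding).card = (I.map e.toEmbedding).card := by simp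
    have htop : IsTopSet b (I.map f.toEmbedding) := by
      intro i hi j hj
      obtain ⟨i', hi', rfl⟩ := Finset.mem_map.mp hi
      have hj' : f.symm j ∉ I := fun hjI => hj (Finset.mem_map.mpr ⟨_, hjI, by simp⟩)
      simp only [I, Finset.mem_filter, Finset.mem_univ, true_and, not_le] at hi' hj'
      have := hf (show i' ≤ f.symm j from Fin.le_def.mpr (by omega))
      simpa using this
    obtain ⟨t, ht, hle⟩ := h (I.map e.toEmbedding) (by
      intro i hi
      obtain ⟨i', hi', rfl⟩ := Finset.mem_map.mp hi
      simp only [I, Finset.mem_filter, Finset.mem_univ, true_and] at hi'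
      exact hck.trans_le (he (Fin.le_def.mpr hi')))
    have h2 := hle.trans (htop.sum_le (ht.trans hcard.symm))
    rw [Finset.sum_map, Finset.sum_map] at h2
    have h3 : ∑ i ∈ Finset.range (k + 1), δ i = ∑ i ∈ I, (b (f i) - a (e i)) := by
      symm
      refine Finset.sum_bij (fun i _ => i.val) ?_ ?_ ?_ ?_
      · intro i hi
        simp only [I, Finset.mem_filter, Finset.mem_univ, true_and] at hi
        simp; omega
      · intro i _ j _ hij; exact Fin.ext hij
      · intro i hi
        simp only [Finset.mem_range] at hi
        exact ⟨⟨i, by omega⟩, by simp [I]; omega, rfl⟩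
      · intro i _
        simp [δ]
    rw [h3, Finset.sum_sub_distrib]
    simpa using h2

/-- Balls of `Φ` are convex, so it suffices that `a` lies in the convex hull of the signed
permutations of `b`. A functional separating `a` from the hull is contradicted by choosing signs to
match its coefficients and a permutation by rearrangement. -/
theorem WeakMaj.seminorm_le {a b : m → ℝ} (h : WeakMaj a b) (ha : ∀ i, 0 ≤ a i)
    (Φ : Seminorm ℝ (m → ℝ))
    (hΦ : ∀ (ε : m → ℤˣ) (σ : Equiv.Perm m), Φ (fun i => ((ε i : ℤ) : ℝ) * b (σ i)) ≤ Φ b) :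
    Φ a ≤ Φ b := by
  let g : (m → ℤˣ) × Equiv.Perm m → m → ℝ := fun q i => ((q.1 i : ℤ) : ℝ) * b (q.2 i)
  suffices hmem : a ∈ convexHull ℝ (Set.range g) by
    have hsub : Set.range g ⊆ Φ.closedBall 0 (Φ b) := by
      rintro _ ⟨q, rfl⟩
      rw [Seminorm.mem_closedBall_zero]
      exact hΦ q.1 q.2
    have := convexHull_min hsub (Φ.convex_closedBall 0 (Φ b)) hmem
    rwa [Seminorm.mem_closedBall_zero] at this
  by_contra hmem
  obtain ⟨f, u, hlt, hu⟩ := geometric_hahn_banach_closed_point (convex_convexHull ℝ _)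
    ((Set.finite_range g).isClosed_convexHull ℝ) hmem
  let c : m → ℝ := fun i => f (Pi.single i 1)
  have hf : ∀ x, f x = ∑ i, c i * x i := by
    intro x
    conv_lhs => rw [← Finset.univ_sum_single x]
    rw [map_sum]
    refine Finset.sum_congr rfl fun i _ => ?_
    rw [show (Pi.single i (x i) : m → ℝ) = x i • Pi.single i 1 by
      rw [← Pi.single_smul]; simp, map_smul, smul_eq_mul, mul_comm]
  obtain ⟨σ, hσ⟩ := exists_perm_sum_mul_le (c := fun i => |c i|) (fun i => abs_nonneg _)
    (fun s _ => h s)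
  let ε : m → ℤˣ := fun i => if 0 ≤ c i then 1 else -1
  have h1 : f a ≤ ∑ i, |c i| * a i := by
    rw [hf]
    exact Finset.sum_le_sum fun i _ => mul_le_mul_of_nonneg_right (le_abs_self _) (ha i)
  have h2 : f (g (ε, σ)) = ∑ i, |c i| * b (σ i) := by
    rw [hf]
    refine Finset.sum_congr rfl fun i _ => ?_
    by_cases hi : 0 ≤ c i
    · simp [g, ε, hi, abs_of_nonneg hi]
    · simp [g, ε, hi, abs_of_neg (not_le.mp hi)]
  have h3 := hlt _ (subset_convexHull ℝ _ ⟨(ε, σ), rfl⟩)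
  linarith

/-- The tangent line of `exp` gives `b^p - a^p ≥ p * a^p * (log b - log a)`. Summed over `s`, the
right side is nonnegative by rearrangement with weights `a^p`; indices with `a i = 0` have weight
zero, so the value of `log 0` is harmless. -/
theorem weakMaj_rpow_of_prod_le {a b : m → ℝ} (ha : ∀ i, 0 ≤ a i) (hb : ∀ i, 0 < b i) {p : ℝ}
    (hp : 0 < p)
    (h : ∀ s : Finset m, ∃ t : Finset m, t.card = s.card ∧ ∏ i ∈ s, a i ≤ ∏ i ∈ t, b i) :
    WeakMaj (fun i => a i ^ p) (fun i => b i ^ p) := by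
  intro s
  have hpos : ∀ i, ¬ 0 < a i → a i = 0 := fun i hi => le_antisymm (not_lt.mp hi) (ha i)
  obtain ⟨σ, hσ⟩ := exists_perm_sum_mul_le (a := fun i => Real.log (a i))
    (b := fun i => Real.log (b i)) (c := fun i => if i ∈ s then a i ^ p else 0)
    (fun i => by split_ifs; exacts [Real.rpow_nonneg (ha i) p, le_rfl]) (by
      intro s' hs'
      have hpos' : ∀ i ∈ s', 0 < a i := by
        intro i hi
        by_contra hcon
        have := hs' i hi
        simp [hpos i hcon, Real.zero_rpow hp.ne'] at this
      obtain ⟨t, ht, hle⟩ := h s'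
      refine ⟨t, ht, ?_⟩
      rw [← Real.log_prod fun i hi => (hpos' i hi).ne', ← Real.log_prod fun i _ => (hb i).ne']
      exact Real.log_le_log (Finset.prod_pos hpos') hle)
  refine ⟨s.map σ.toEmbedding, by simp, ?_⟩
  rw [Finset.sum_map]
  have hterm : ∀ i ∈ s, p * (a i ^ p * Real.log (b (σ i)) - a i ^ p * Real.log (a i)) ≤
      b (σ i) ^ p - a i ^ p := by
    intro i _
    by_cases hi : 0 < a i
    · have h1 := Real.add_one_le_exp (p * (Real.log (b (σ i)) - Real.log (a i)))
      have h2 : b (σ i) ^ p = a i ^ p * Real.exp (p * (Real.log (b (σ i)) - Real.log (a i))) := by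
        rw [Real.rpow_def_of_pos (hb _), Real.rpow_def_of_pos hi, ← Real.exp_add]
        ring_nf
      have h3 := mul_le_mul_of_nonneg_left h1 (Real.rpow_nonneg (ha i) p)
      rw [h2]
      linarith
    · rw [hpos i hi, Real.zero_rpow hp.ne']
      simpa using Real.rpow_nonneg (hb _).le p
  have hsum := Finset.sum_le_sum hterm
  rw [← Finset.mul_sum, Finset.sum_sub_distrib, Finset.sum_sub_distrib] at hsum
  simp only [ite_mul, zero_mul, Finset.sum_ite_mem, Finset.univ_inter] at hσ
  have := mul_nonneg hp.le (sub_nonneg.mpr hσ)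
  simpa using (sub_nonneg.mp (this.trans hsum))

end WeakMajorization

/-! ### Spectral decomposition and Ky Fan's principle. -/

section Spectral

namespace Matrix

theorem PosSemidef.re_diag_nonneg {m : Type*} {A : Matrix m m ℂ} (hA : A.PosSemidef) (i : m) :
    0 ≤ (A i i).re :=
  (Complex.le_def.mp (hA.diag_nonneg (i := i))).1

theorem re_conj_diag_le {m : Type*} [Fintype m] {A B : Matrix m m ℂ} (h : A ≤ B) (U : Matrix m m ℂ) (i : m) :
    ((star U * A * U) i i).re ≤ ((star U * B * U) i i).re := by
  have h1 := ((le_iff.mp h).conjTranspose_mul_mul_same U).re_diag_nonneg i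
  rw [mul_sub, sub_mul, Matrix.sub_apply, Complex.sub_re] at h1
  exact sub_nonneg.mp h1

variable {m : Type*} [Fintype m] [DecidableEq m]

theorem star_mul_self_of_unitary (U : Matrix.unitaryGroup m ℂ) :
    star (U : Matrix m m ℂ) * (U : Matrix m m ℂ) = 1 :=
  (Matrix.mem_unitaryGroup_iff').mp U.2

theorem self_mul_star_of_unitary (U : Matrix.unitaryGroup m ℂ) :
    (U : Matrix m m ℂ) * star (U : Matrix m m ℂ) = 1 :=
  (Matrix.mem_unitaryGroup_iff).mp U.2

theorem sum_normSq_row (U : Matrix.unitaryGroup m ℂ) (i : m) :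
    ∑ j, Complex.normSq ((U : Matrix m m ℂ) i j) = 1 := by
  have h := congrFun (congrFun (self_mul_star_of_unitary U) i) i
  rw [Matrix.mul_apply, Matrix.one_apply_eq] at h
  have h2 : ∀ j, (U : Matrix m m ℂ) i j * star (U : Matrix m m ℂ) j i =
      ((Complex.normSq ((U : Matrix m m ℂ) i j) : ℝ) : ℂ) := by
    intro j
    rw [Matrix.star_apply, ← Complex.mul_conj]; rfl
  simp_rw [h2] at h
  exact_mod_cast h

theorem sum_normSq_col (U : Matrix.unitaryGroup m ℂ) (j : m) :
    ∑ i, Complex.normSq ((U : Matrix m m ℂ) i j) = 1 := by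
  have h := sum_normSq_row (star U) j
  simpa [Matrix.star_apply, Complex.normSq_conj] using h

theorem IsHermitian.cfc_eq_mul {A : Matrix m m ℂ} (hA : A.IsHermitian) (f : ℝ → ℝ) :
    cfc f A = (hA.eigenvectorUnitary : Matrix m m ℂ) *
      diagonal (fun i => ((f (hA.eigenvalues i) : ℝ) : ℂ)) *
      star (hA.eigenvectorUnitary : Matrix m m ℂ) := by
  rw [hA.cfc_eq, IsHermitian.cfc, Unitary.conjStarAlgAut_apply]
  rfl

theorem IsHermitian.eq_mul {A : Matrix m m ℂ} (hA : A.IsHermitian) :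
    A = (hA.eigenvectorUnitary : Matrix m m ℂ) *
      diagonal (fun i => ((hA.eigenvalues i : ℝ) : ℂ)) *
      star (hA.eigenvectorUnitary : Matrix m m ℂ) := by
  conv_lhs => rw [hA.spectral_theorem, Unitary.conjStarAlgAut_apply]
  rfl

theorem star_mul_conj_mul (U : Matrix.unitaryGroup m ℂ) (D : Matrix m m ℂ) :
    star (U : Matrix m m ℂ) * ((U : Matrix m m ℂ) * D * star (U : Matrix m m ℂ)) *
      (U : Matrix m m ℂ) = D := by
  calc _ = (star (U : Matrix m m ℂ) * (U : Matrix m m ℂ)) * D *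
        (star (U : Matrix m m ℂ) * (U : Matrix m m ℂ)) := by simp only [mul_assoc]
    _ = D := by rw [star_mul_self_of_unitary, one_mul, mul_one]

theorem IsHermitian.star_mul_mul {A : Matrix m m ℂ} (hA : A.IsHermitian) :
    star (hA.eigenvectorUnitary : Matrix m m ℂ) * A * (hA.eigenvectorUnitary : Matrix m m ℂ) =
      diagonal (fun i => ((hA.eigenvalues i : ℝ) : ℂ)) := by
  conv_lhs => enter [1, 2]; rw [hA.eq_mul]
  exact star_mul_conj_mul _ _

theorem PosSemidef.rpow_eq_cfc {A : Matrix m m ℂ} (hA : A.PosSemidef) (p : ℝ) :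
    A ^ p = cfc (fun x : ℝ => x ^ p) A :=
  CFC.rpow_eq_cfc_real (nonneg_iff_posSemidef.mpr hA)

theorem IsHermitian.abs_eq_cfc {A : Matrix m m ℂ} (hA : A.IsHermitian) :
    CFC.abs A = cfc (fun x : ℝ => |x|) A :=
  CFC.abs_eq_cfc_norm A hA.isSelfAdjoint

theorem IsHermitian.abs_rpow_eq_cfc {A : Matrix m m ℂ} (hA : A.IsHermitian) (p : ℝ) :
    CFC.abs A ^ p = cfc (fun x : ℝ => |x| ^ p) A := by
  rw [(nonneg_iff_posSemidef.mp (CFC.abs_nonneg A)).rpow_eq_cfc, hA.abs_eq_cfc,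
    ← cfc_comp' (fun x : ℝ => x ^ p) (fun x : ℝ => |x|) A
      ((A.finite_real_spectrum.image _).continuousOn _)
      (A.finite_real_spectrum.continuousOn _) hA.isSelfAdjoint]

theorem rpow_nonneg_of_posSemidef {A : Matrix m m ℂ} (p : ℝ) : (A ^ p).PosSemidef :=
  nonneg_iff_posSemidef.mp CFC.rpow_nonneg

/-- Ky Fan's maximum principle. -/
theorem IsHermitian.weakMaj_diag {A : Matrix m m ℂ} (hA : A.IsHermitian)
    (U : Matrix.unitaryGroup m ℂ) :
    WeakMaj (fun i => ((star (U : Matrix m m ℂ) * A * (U : Matrix m m ℂ)) i i).re)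
      hA.eigenvalues := by
  intro s
  let W : Matrix.unitaryGroup m ℂ := star hA.eigenvectorUnitary * U
  have hW : star (U : Matrix m m ℂ) * A * (U : Matrix m m ℂ) =
      star (W : Matrix m m ℂ) * diagonal (fun i => ((hA.eigenvalues i : ℝ) : ℂ)) *
        (W : Matrix m m ℂ) := by
    conv_lhs => enter [1, 2]; rw [hA.eq_mul]
    simp [W, mul_assoc]
  have hdiag : ∀ i, ((star (U : Matrix m m ℂ) * A * (U : Matrix m m ℂ)) i i).re =
      ∑ j, Complex.normSq ((W : Matrix m m ℂ) j i) * hA.eigenvalues j := by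
    intro i
    rw [hW, Matrix.mul_apply, Complex.re_sum]
    refine Finset.sum_congr rfl fun j _ => ?_
    rw [Matrix.mul_diagonal, Matrix.star_apply, Complex.normSq_apply]
    simp
    ring
  obtain ⟨t, ht, htop⟩ := exists_isTopSet hA.eigenvalues s.card_le_univ
  refine ⟨t, ht, ?_⟩
  simp only [hdiag]
  rw [Finset.sum_comm]
  simp only [← Finset.sum_mul]
  -- The weight of `j` is the sum of `|W j i|²` over `i ∈ s`: at most a full row sum, which is 1,
  -- with total `s.card` from the columns.
  refine htop.sum_mul_le (fun j => Finset.sum_nonneg fun i _ => Complex.normSq_nonneg _)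
    (fun j => ?_) ?_
  · rw [← sum_normSq_row W j]
    exact Finset.sum_le_sum_of_subset_of_nonneg (Finset.subset_univ _)
      fun i _ _ => Complex.normSq_nonneg _
  · rw [Finset.sum_comm, ht]
    simp [sum_normSq_col]

theorem IsHermitian.weakMaj_eigenvalues_of_le {A B : Matrix m m ℂ} (hA : A.IsHermitian)
    (hB : B.IsHermitian) (h : A ≤ B) : WeakMaj hA.eigenvalues hB.eigenvalues := by
  refine WeakMaj.of_le_left (fun i => ?_) (hB.weakMaj_diag hA.eigenvectorUnitary)
  refine le_trans (le_of_eq ?_) (re_conj_diag_le h _ i)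
  rw [hA.star_mul_mul]
  simp

end Matrix

end Spectral

/-! ### Symmetric norms as functions of eigenvalues. -/

namespace SymmetricNorm

variable {m : Type*} [Fintype m] [DecidableEq m] (N : SymmetricNorm m)

theorem apply_unitary_mul_mul (U V : Matrix.unitaryGroup m ℂ) (X : Matrix m m ℂ) :
    N ((U : Matrix m m ℂ) * X * (V : Matrix m m ℂ)) = N X :=
  N.unitarily_invariant' _ U.2 _ V.2 X

theorem apply_conj_star (U : Matrix.unitaryGroup m ℂ) (X : Matrix m m ℂ) :
    N ((U : Matrix m m ℂ) * X * star (U : Matrix m m ℂ)) = N X :=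
  N.apply_unitary_mul_mul U (star U) X

/-- The diagonal matrix of a real vector, as a real linear map. -/
noncomputable def diagonalLinearMap (m : Type*) [DecidableEq m] :
    (m → ℝ) →ₗ[ℝ] Matrix m m ℂ where
  toFun x := Matrix.diagonal fun i => (x i : ℂ)
  map_add' x y := by
    rw [Matrix.diagonal_add]; simp
  map_smul' r x := by
    ext i j
    by_cases h : i = j
    · subst h; simp
    · simp [h]

/-- The seminorm `x ↦ ‖diag x‖` on real vectors. -/
noncomputable def diagSeminorm : Seminorm ℝ (m → ℝ) :=
  (N.toSeminorm.restrictScalars ℝ).comp (diagonalLinearMap m)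

theorem diagSeminorm_apply (x : m → ℝ) :
    N.diagSeminorm x = N (Matrix.diagonal fun i => (x i : ℂ)) := rfl

theorem diagSeminorm_perm (ε : m → ℤˣ) (σ : Equiv.Perm m) (b : m → ℝ) :
    N.diagSeminorm (fun i => ((ε i : ℤ) : ℝ) * b (σ i)) = N.diagSeminorm b := by
  have hε : Matrix.diagonal (fun i => ((ε i : ℤ) : ℂ)) ∈ Matrix.unitaryGroup m ℂ := by
    rw [Matrix.mem_unitaryGroup_iff, Matrix.star_eq_conjTranspose,
      Matrix.diagonal_conjTranspose, Matrix.diagonal_mul_diagonal, ← Matrix.diagonal_one]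
    congr 1
    ext i
    rcases Int.units_eq_one_or (ε i) with h | h <;> simp [h]
  have hσ : ∀ τ : Equiv.Perm m, τ.permMatrix ℂ ∈ Matrix.unitaryGroup m ℂ := by
    intro τ
    rw [Matrix.mem_unitaryGroup_iff, Matrix.star_eq_conjTranspose,
      Matrix.conjTranspose_permMatrix, ← Matrix.permMatrix_mul]
    simp
  rw [diagSeminorm_apply, diagSeminorm_apply, ← N.apply_unitary_mul_mul
    ⟨_, mul_mem hε (hσ σ)⟩ ⟨_, hσ σ⁻¹⟩ (Matrix.diagonal fun i => (b i : ℂ))]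
  congr 1
  ext i j
  have hinv : Equiv.symm σ⁻¹ = σ := rfl
  by_cases hij : i = j <;>
    simp [PEquiv.mul_toMatrix_toPEquiv, hinv, hij]

theorem apply_isHermitian {A : Matrix m m ℂ} (hA : A.IsHermitian) :
    N A = N.diagSeminorm hA.eigenvalues := by
  conv_lhs => rw [hA.eq_mul]
  exact N.apply_conj_star _ _

theorem apply_cfc {A : Matrix m m ℂ} (hA : A.IsHermitian) (f : ℝ → ℝ) :
    N (cfc f A) = N.diagSeminorm fun i => f (hA.eigenvalues i) := by
  rw [hA.cfc_eq_mul]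
  exact N.apply_conj_star _ _

theorem diagSeminorm_mono {a b : m → ℝ} (ha : ∀ i, 0 ≤ a i) (h : WeakMaj a b) :
    N.diagSeminorm a ≤ N.diagSeminorm b :=
  h.seminorm_le ha _ fun ε σ => (N.diagSeminorm_perm ε σ b).le

theorem mono {A B : Matrix m m ℂ} (hA : A.PosSemidef) (h : A ≤ B) : N A ≤ N B := by
  have hB : B.PosSemidef := Matrix.nonneg_iff_posSemidef.mp
    ((Matrix.nonneg_iff_posSemidef.mpr hA).trans h)
  rw [N.apply_isHermitian hA.1, N.apply_isHermitian hB.1]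
  exact N.diagSeminorm_mono hA.eigenvalues_nonneg (hA.1.weakMaj_eigenvalues_of_le hB.1 h)

theorem apply_eq_of_charpoly_eq {A B : Matrix m m ℂ} (hA : A.IsHermitian) (hB : B.IsHermitian)
    (h : A.charpoly = B.charpoly) : N A = N B := by
  rw [N.apply_isHermitian hA, N.apply_isHermitian hB,
    (Matrix.IsHermitian.eigenvalues_eq_eigenvalues_iff hA hB).mpr h]

end SymmetricNorm

/-! ### Determinant comparison and log-majorization. -/

namespace Matrix

theorem submatrix_mono {m k : Type*} {A B : Matrix m m ℂ} (h : A ≤ B) (e : k → m) :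
    A.submatrix e e ≤ B.submatrix e e :=
  (le_iff.mp h).submatrix e

theorem posDef_of_smul_one_le {m : Type*} [DecidableEq m] {R : Matrix m m ℂ} {θ : ℝ} (hθ : 0 < θ)
    (h : (θ : ℂ) • (1 : Matrix m m ℂ) ≤ R) : R.PosDef := by
  have h1 : ((θ : ℂ) • (1 : Matrix m m ℂ)).PosDef :=
    PosDef.one.smul (by exact_mod_cast hθ)
  have := h1.add_posSemidef (le_iff.mp h)
  simpa using this

section Determinant

variable {m : Type*} [Fintype m] [DecidableEq m]

theorem IsHermitian.abs_eigenvalues_le_one {K : Matrix m m ℂ} (hK : K.IsHermitian)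
    (h₁ : -1 ≤ K) (h₂ : K ≤ 1) (i : m) : |hK.eigenvalues i| ≤ 1 := by
  have hd : ∀ c : ℝ, ((star (hK.eigenvectorUnitary : Matrix m m ℂ) *
      ((c : ℂ) • (1 : Matrix m m ℂ)) * (hK.eigenvectorUnitary : Matrix m m ℂ)) i i).re = c := by
    intro c
    rw [mul_smul_comm, smul_mul_assoc, mul_one, star_mul_self_of_unitary]
    simp
  have hk : ((star (hK.eigenvectorUnitary : Matrix m m ℂ) * K *
      (hK.eigenvectorUnitary : Matrix m m ℂ)) i i).re = hK.eigenvalues i := by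
    rw [hK.star_mul_mul]; simp
  have e1 := re_conj_diag_le h₁ (hK.eigenvectorUnitary : Matrix m m ℂ) i
  have e2 := re_conj_diag_le h₂ (hK.eigenvectorUnitary : Matrix m m ℂ) i
  have d1 := hd (-1)
  have d2 := hd 1
  simp only [Complex.ofReal_neg, Complex.ofReal_one, neg_smul, one_smul] at d1 d2
  rw [hk] at e1 e2
  rw [d1] at e1
  rw [d2] at e2
  exact abs_le.mpr ⟨e1, e2⟩

theorem norm_det_le_one {K : Matrix m m ℂ} (h₁ : -1 ≤ K) (h₂ : K ≤ 1) : ‖K.det‖ ≤ 1 := by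
  have hK : K.IsHermitian := by
    have := (isHermitian_one (n := m) (α := ℂ)).sub (le_iff.mp h₂).1
    simpa using this
  rw [hK.det_eq_prod_eigenvalues, norm_prod]
  refine Finset.prod_le_one (fun i _ => norm_nonneg _) fun i _ => ?_
  rw [RCLike.norm_ofReal]
  exact hK.abs_eigenvalues_le_one h₁ h₂ i

/-- Congruence by the inverse of a factor `B` with `P = B* B` turns `P` into the identity, and a
matrix between `-1` and `1` has eigenvalues of modulus at most 1. -/
theorem PosDef.norm_det_le {P X : Matrix m m ℂ} (hP : P.PosDef) (h₁ : -P ≤ X) (h₂ : X ≤ P) :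
    ‖X.det‖ ≤ ‖P.det‖ := by
  obtain ⟨B, hB⟩ := CStarAlgebra.nonneg_iff_eq_star_mul_self.mp
    (nonneg_iff_posSemidef.mpr hP.posSemidef)
  have hdet : IsUnit B.det := by
    have h := hP.det_pos.ne'
    rw [hB, det_mul] at h
    exact isUnit_iff_ne_zero.mpr (right_ne_zero_of_mul h)
  have hBB : B * B⁻¹ = 1 := mul_nonsing_inv B hdet
  have hBB' : star B⁻¹ * star B = 1 := by rw [← star_mul, hBB, star_one]
  have hBB2 : B⁻¹ * B = 1 := nonsing_inv_mul B hdet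
  have hBB2' : star B * star B⁻¹ = 1 := by rw [← star_mul, hBB2, star_one]
  have hone : star B⁻¹ * P * B⁻¹ = 1 := by
    rw [hB]
    calc _ = (star B⁻¹ * star B) * (B * B⁻¹) := by simp only [mul_assoc]
      _ = 1 := by rw [hBB, hBB', mul_one]
  have k1 := star_left_conjugate_le_conjugate h₁ B⁻¹
  have k2 := star_left_conjugate_le_conjugate h₂ B⁻¹
  rw [hone] at k2
  rw [mul_neg, neg_mul, hone] at k1
  have hX : X = star B * (star B⁻¹ * X * B⁻¹) * B := by
    calc X = (star B * star B⁻¹) * X * (B⁻¹ * B) := by rw [hBB2, hBB2', one_mul, mul_one]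
      _ = _ := by simp only [mul_assoc]
  have := norm_det_le_one k1 k2
  generalize star B⁻¹ * X * B⁻¹ = K at hX this
  rw [hX, hB, det_mul, det_mul, det_mul, norm_mul, norm_mul, norm_mul]
  nlinarith [mul_nonneg (norm_nonneg (star B).det) (norm_nonneg B.det)]

theorem norm_det_smul_one {c : ℝ} (hc : 0 ≤ c) :
    ‖((c : ℂ) • (1 : Matrix m m ℂ)).det‖ = c ^ Fintype.card m := by
  simp [abs_of_nonneg hc]

/-- `det R` is the determinant of the corner times that of its Schur complement, and the Schur
complement inherits the lower bound `θ`. -/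
theorem norm_det_toBlocks₁₁_mul_le {k : Type*} [Fintype k] [DecidableEq k]
    {R : Matrix (m ⊕ k) (m ⊕ k) ℂ} {θ : ℝ} (hθ : 0 < θ)
    (h : (θ : ℂ) • (1 : Matrix (m ⊕ k) (m ⊕ k) ℂ) ≤ R) :
    ‖R.toBlocks₁₁.det‖ * θ ^ Fintype.card k ≤ ‖R.det‖ := by
  have hR := posDef_of_smul_one_le hθ h
  obtain ⟨A, B, C, D, rfl⟩ : ∃ A B C D, R = fromBlocks A B C D :=
    ⟨_, _, _, _, (fromBlocks_toBlocks R).symm⟩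
  obtain ⟨-, hC, -, -⟩ := isHermitian_fromBlocks_iff.mp hR.1
  subst hC
  rw [toBlocks_fromBlocks₁₁]
  have hA : A.PosDef := hR.submatrix (e := Sum.inl) Sum.inl_injective
  let := hA.isUnit.invertible
  have hS : (D - (θ : ℂ) • (1 : Matrix k k ℂ) - Bᴴ * A⁻¹ * B).PosSemidef := by
    rw [← hA.fromBlocks₁₁]
    -- Adding `θ` back on the first block leaves `R` with only its lower block reduced by `θ`, still
    -- positive semidefinite; its Schur complement is the matrix in `hS`.
    have h1 := le_iff.mp h
    have h2 : (fromBlocks ((θ : ℂ) • (1 : Matrix m m ℂ)) 0 0 (0 : Matrix k k ℂ)).PosSemidef := by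
      have : fromBlocks ((θ : ℂ) • (1 : Matrix m m ℂ)) 0 0 (0 : Matrix k k ℂ) =
          diagonal (Sum.elim (fun _ => (θ : ℂ)) 0) := by
        rw [← fromBlocks_diagonal, smul_one_eq_diagonal]; simp
      rw [this]
      refine PosSemidef.diagonal fun i => ?_
      rcases i with i | i
      · simpa using hθ.le
      · simp
    have := h1.add h2
    rw [← fromBlocks_one, fromBlocks_smul, sub_eq_add_neg, fromBlocks_neg, fromBlocks_add,
      fromBlocks_add] at this
    simpa [sub_eq_add_neg] using this
  have hle : (θ : ℂ) • (1 : Matrix k k ℂ) ≤ D - Bᴴ * A⁻¹ * B := by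
    rwa [le_iff, sub_right_comm]
  have hpos : -(D - Bᴴ * A⁻¹ * B) ≤ (θ : ℂ) • (1 : Matrix k k ℂ) := by
    refine le_trans (neg_nonpos.mpr ?_) ?_
    · exact nonneg_iff_posSemidef.mpr (posDef_of_smul_one_le hθ hle).posSemidef
    · exact nonneg_iff_posSemidef.mpr (PosSemidef.one.smul (by exact_mod_cast hθ.le))
  have := (posDef_of_smul_one_le hθ hle).norm_det_le hpos hle
  rw [norm_det_smul_one hθ.le] at this
  rw [det_fromBlocks₁₁, norm_mul, invOf_eq_nonsing_inv]
  exact mul_le_mul_of_nonneg_left this (norm_nonneg _)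

theorem norm_det_submatrix_mul_le {R : Matrix m m ℂ} {θ : ℝ} (hθ : 0 < θ)
    (h : (θ : ℂ) • (1 : Matrix m m ℂ) ≤ R) (s : Finset m) :
    ‖(R.submatrix (Subtype.val : {i // i ∈ s} → m) Subtype.val).det‖ *
      θ ^ (Fintype.card m - s.card) ≤ ‖R.det‖ := by
  let e := Equiv.sumCompl (fun i => i ∈ s)
  have h2 : (θ : ℂ) • (1 : Matrix _ _ ℂ) ≤ R.submatrix e e := by
    rw [le_iff]
    have := (le_iff.mp h).submatrix e
    simpa [submatrix_sub, submatrix_smul] using this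
  have h3 := norm_det_toBlocks₁₁_mul_le hθ h2
  rw [det_submatrix_equiv_self] at h3
  have hc : Fintype.card {i // i ∉ s} = Fintype.card m - s.card := by
    rw [Fintype.card_subtype_compl]; simp
  rw [hc] at h3
  exact h3

/-- Principal minors of a positive definite matrix are dominated by products of eigenvalues. -/
theorem PosDef.exists_norm_det_submatrix_le {P : Matrix m m ℂ} (hP : P.PosDef)
    (U : Matrix.unitaryGroup m ℂ) (s : Finset m) :
    ∃ t : Finset m, t.card = s.card ∧
      ‖((star (U : Matrix m m ℂ) * P * (U : Matrix m m ℂ)).submatrix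
        (Subtype.val : {i // i ∈ s} → m) Subtype.val).det‖ ≤ ∏ i ∈ t, hP.1.eigenvalues i := by
  rcases s.eq_empty_or_nonempty with rfl | hne
  · exact ⟨∅, rfl, by simp⟩
  obtain ⟨t, ht, htop⟩ := exists_isTopSet hP.1.eigenvalues s.card_le_univ
  refine ⟨t, ht, ?_⟩
  have htne : t.Nonempty := by rw [← Finset.card_pos, ht]; exact hne.card_pos
  obtain ⟨x, hx, hmin⟩ := Finset.exists_min_image t hP.1.eigenvalues htne
  set θ := hP.1.eigenvalues x with hθdef
  have hθ : 0 < θ := hP.eigenvalues_pos x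
  -- Here `θ` is the `s.card`-th largest eigenvalue. Raising smaller eigenvalues to `θ` only
  -- increases `P` and makes its determinant the product over `t` times `θ ^ (card m - s.card)`;
  -- passing to the minor on `s` removes exactly this power.
  let f : ℝ → ℝ := fun y => max y θ
  have hcont : ∀ g : ℝ → ℝ, ContinuousOn g (spectrum ℝ P) := fun g =>
    P.finite_real_spectrum.continuousOn g
  have hPf : P ≤ cfc f P := by
    conv_lhs => rw [← cfc_id ℝ P hP.1.isSelfAdjoint]
    exact cfc_mono (fun y _ => le_max_left y θ) (hcont _) (hcont _)
  have hθf : (θ : ℂ) • (1 : Matrix m m ℂ) ≤ cfc f P := by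
    have h1 : cfc (fun _ => θ) P ≤ cfc f P :=
      cfc_mono (fun y _ => le_max_right y θ) (hcont _) (hcont _)
    rw [cfc_const θ P hP.1.isSelfAdjoint, Algebra.algebraMap_eq_smul_one] at h1
    simpa using h1
  set Q := star (U : Matrix m m ℂ) * cfc f P * (U : Matrix m m ℂ)
  have hθQ : (θ : ℂ) • (1 : Matrix m m ℂ) ≤ Q := by
    have := star_left_conjugate_le_conjugate hθf (U : Matrix m m ℂ)
    rwa [mul_smul_comm, smul_mul_assoc, mul_one, star_mul_self_of_unitary] at this
  have hPQ : star (U : Matrix m m ℂ) * P * (U : Matrix m m ℂ) ≤ Q :=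
    star_left_conjugate_le_conjugate hPf (U : Matrix m m ℂ)
  have hP0 : (0 : Matrix m m ℂ) ≤ star (U : Matrix m m ℂ) * P * (U : Matrix m m ℂ) :=
    star_left_conjugate_nonneg (nonneg_iff_posSemidef.mpr hP.posSemidef) _
  have hQ : Q.PosDef := posDef_of_smul_one_le hθ hθQ
  let ι : {i // i ∈ s} → m := Subtype.val
  have hsub : ‖((star (U : Matrix m m ℂ) * P * (U : Matrix m m ℂ)).submatrix ι ι).det‖ ≤
      ‖(Q.submatrix ι ι).det‖ := by
    refine (hQ.submatrix Subtype.val_injective).norm_det_le ?_ ?_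
    · refine le_trans (neg_nonpos.mpr ?_) ?_
      · exact nonneg_iff_posSemidef.mpr (hQ.submatrix Subtype.val_injective).posSemidef
      · exact nonneg_iff_posSemidef.mpr ((nonneg_iff_posSemidef.mp hP0).submatrix _)
    · exact submatrix_mono hPQ ι
  have hdetQ : ‖Q.det‖ =
      (∏ i ∈ t, hP.1.eigenvalues i) * θ ^ (Fintype.card m - s.card) := by
    have h1 : Q.det = (diagonal fun i => ((f (hP.1.eigenvalues i) : ℝ) : ℂ)).det := by
      have hu : (star (U : Matrix m m ℂ)).det * (U : Matrix m m ℂ).det = 1 := by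
        rw [← det_mul, star_mul_self_of_unitary, det_one]
      have hv : (hP.1.eigenvectorUnitary : Matrix m m ℂ).det *
          (star (hP.1.eigenvectorUnitary : Matrix m m ℂ)).det = 1 := by
        rw [← det_mul, self_mul_star_of_unitary, det_one]
      simp only [Q, hP.1.cfc_eq_mul, det_mul]
      linear_combination (diagonal fun i => ((f (hP.1.eigenvalues i) : ℝ) : ℂ)).det *
        ((hP.1.eigenvectorUnitary : Matrix m m ℂ).det *
          (star (hP.1.eigenvectorUnitary : Matrix m m ℂ)).det * hu + hv)
    rw [h1, det_diagonal, norm_prod, ← Finset.prod_mul_prod_compl t]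
    congr 1
    · refine Finset.prod_congr rfl fun i hi => ?_
      simp only [f, max_eq_left (hmin i hi), Complex.norm_real]
      exact abs_of_pos (hP.eigenvalues_pos i)
    · rw [← ht, ← Finset.card_compl, ← Finset.prod_const]
      refine Finset.prod_congr rfl fun i hi => ?_
      rw [Finset.mem_compl] at hi
      have hfi : f (hP.1.eigenvalues i) = θ := max_eq_right (htop x hx i hi)
      rw [hfi, Complex.norm_real]
      exact abs_of_pos hθ
  have h4 := norm_det_submatrix_mul_le hθ hθQ s
  rw [hdetQ] at h4
  exact hsub.trans (le_of_mul_le_mul_right h4 (pow_pos hθ _))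

/-- In an eigenbasis of `X` the minor on `s` is the product of its eigenvalues there, and
compression preserves `-P ≤ X ≤ P`, so the corresponding minor of `P` dominates it. -/
theorem PosDef.exists_prod_abs_eigenvalues_le {P X : Matrix m m ℂ} (hP : P.PosDef)
    (hX : X.IsHermitian) (h₁ : -P ≤ X) (h₂ : X ≤ P) (s : Finset m) :
    ∃ t : Finset m, t.card = s.card ∧
      ∏ i ∈ s, |hX.eigenvalues i| ≤ ∏ i ∈ t, hP.1.eigenvalues i := by
  obtain ⟨t, ht, hle⟩ := hP.exists_norm_det_submatrix_le hX.eigenvectorUnitary s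
  refine ⟨t, ht, le_trans ?_ hle⟩
  set U := (hX.eigenvectorUnitary : Matrix m m ℂ) with hU
  let ι : {i // i ∈ s} → m := Subtype.val
  have hdet : ‖((star U * X * U).submatrix ι ι).det‖ = ∏ i ∈ s, |hX.eigenvalues i| := by
    rw [hU, hX.star_mul_mul, submatrix_diagonal _ _ Subtype.val_injective, det_diagonal,
      norm_prod, ← Finset.prod_coe_sort s]
    refine Finset.prod_congr rfl fun i _ => ?_
    simp
  rw [← hdet]
  have hQ : (star U * P * U).PosDef :=
    (IsUnit.posDef_star_left_conjugate_iff
      (IsUnit.of_mul_eq_one _ (self_mul_star_of_unitary hX.eigenvectorUnitary))).mpr hP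
  refine (hQ.submatrix Subtype.val_injective).norm_det_le ?_ ?_
  · have := star_left_conjugate_le_conjugate h₁ U
    rw [mul_neg, neg_mul] at this
    exact submatrix_mono this ι
  · exact submatrix_mono (star_left_conjugate_le_conjugate h₂ U) ι

end Determinant

end Matrix

/-! ### The Ando–Zhan inequality for powers; functional calculus. -/

namespace Matrix

theorem re_mul_self_diag {m : Type*} [Fintype m] {a : Matrix m m ℂ} (ha : a.IsHermitian) (i : m) :
    ((a * a) i i).re = ∑ j, Complex.normSq (a i j) := by
  rw [mul_apply, Complex.re_sum]
  refine Finset.sum_congr rfl fun j _ => ?_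
  rw [← ha.apply j i, Complex.star_def, Complex.mul_conj, Complex.ofReal_re]

variable {m : Type*} [Fintype m] [DecidableEq m]

section AntitonePower

open scoped Matrix.Norms.L2Operator

/-- Löwner–Heinz for the exponent `-q`, followed by inversion, which reverses the order. -/
theorem PosDef.rpow_le_rpow_of_nonpos {A Z : Matrix m m ℂ} (hA : A.PosDef) (h : A ≤ Z) {q : ℝ}
    (hq : -1 ≤ q) (hq0 : q ≤ 0) : Z ^ q ≤ A ^ q := by
  have hA' : IsStrictlyPositive A := isStrictlyPositive_iff_posDef.mpr hA
  have hZ' : IsStrictlyPositive Z := hA'.of_le h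
  rcases hq0.eq_or_lt with rfl | hq0
  · rw [CFC.rpow_zero _ hA'.nonneg, CFC.rpow_zero _ hZ'.nonneg]
  have h1 : A ^ (-q) ≤ Z ^ (-q) := CFC.rpow_le_rpow ⟨by linarith, by linarith⟩ h
  have hA2 : IsStrictlyPositive (A ^ (-q)) := by cfc_tac
  have h2 := CStarAlgebra.rpow_neg_one_le_rpow_neg_one h1 hA2
  rwa [CFC.rpow_rpow _ _ _ (by linarith) hZ', CFC.rpow_rpow _ _ _ (by linarith) hA',
    neg_mul_neg, mul_one] at h2

end AntitonePower

theorem re_mul_diagonal_mul_self_diag {a : Matrix m m ℂ} (ha : a.IsHermitian) (d : m → ℝ) (i : m) :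
    ((a * diagonal (fun j => (d j : ℂ)) * a) i i).re = ∑ j, d j * Complex.normSq (a i j) := by
  rw [mul_apply, Complex.re_sum]
  refine Finset.sum_congr rfl fun j _ => ?_
  rw [mul_diagonal, ← ha.apply j i, Complex.star_def, mul_right_comm, Complex.mul_conj,
    ← Complex.ofReal_mul, Complex.ofReal_re, mul_comm]

/-- Both sides are sums of `|a i j|²` over `i ∈ s`, weighted by `d i` and `d j` respectively. The
part with `j ∈ s` agrees by symmetry of `|a i j|²`; elsewhere `d i ≤ d j`. -/
theorem sum_mul_re_sq_diag_le {a : Matrix m m ℂ} (ha : a.IsHermitian) (d : m → ℝ) (s : Finset m)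
    (hd : ∀ i ∈ s, ∀ j ∉ s, d i ≤ d j) :
    ∑ i ∈ s, d i * ((a * a) i i).re ≤
      ∑ i ∈ s, ((a * diagonal (fun j => (d j : ℂ)) * a) i i).re := by
  simp only [re_mul_self_diag ha, re_mul_diagonal_mul_self_diag ha, Finset.mul_sum]
  have hsymm : ∀ i j, Complex.normSq (a i j) = Complex.normSq (a j i) := by
    intro i j
    rw [← ha.apply j i, Complex.star_def, Complex.normSq_conj]
  have hsplit : ∀ F : m → m → ℝ, ∑ i ∈ s, ∑ j, F i j =
      ∑ i ∈ s, ∑ j ∈ s, F i j + ∑ i ∈ s, ∑ j ∈ sᶜ, F i j := by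
    intro F
    rw [← Finset.sum_add_distrib]
    exact Finset.sum_congr rfl fun i _ => (Finset.sum_add_sum_compl s _).symm
  rw [hsplit, hsplit]
  refine add_le_add (le_of_eq ?_) ?_
  · rw [Finset.sum_comm]
    exact Finset.sum_congr rfl fun i _ => Finset.sum_congr rfl fun j _ => by rw [hsymm]
  · refine Finset.sum_le_sum fun i hi => Finset.sum_le_sum fun j hj => ?_
    exact mul_le_mul_of_nonneg_right (hd i hi j (Finset.mem_compl.mp hj)) (Complex.normSq_nonneg _)

/-- With `H = A^(1/2)`, antitonicity gives `H Z^(p-1) H ≤ H A^(p-1) H = A^p`. In an eigenbasis of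
`Z` the weights `λ^(p-1)` are smallest on a top set, so the preceding lemma moves them inside. -/
theorem PosDef.sum_rpow_mul_diag_le {A Z : Matrix m m ℂ} (hA : A.PosDef) (hZ : Z.PosDef)
    (h : A ≤ Z) {p : ℝ} (hp0 : 0 ≤ p) (hp1 : p ≤ 1) {s : Finset m}
    (hs : IsTopSet hZ.1.eigenvalues s) :
    ∑ i ∈ s, hZ.1.eigenvalues i ^ (p - 1) *
        ((star (hZ.1.eigenvectorUnitary : Matrix m m ℂ) * A *
          (hZ.1.eigenvectorUnitary : Matrix m m ℂ)) i i).re ≤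
      ∑ i ∈ s, ((star (hZ.1.eigenvectorUnitary : Matrix m m ℂ) * A ^ p *
          (hZ.1.eigenvectorUnitary : Matrix m m ℂ)) i i).re := by
  have hA' : IsStrictlyPositive A := isStrictlyPositive_iff_posDef.mpr hA
  set U := (hZ.1.eigenvectorUnitary : Matrix m m ℂ) with hU
  have hUU : U * star U = 1 := self_mul_star_of_unitary _
  set H := A ^ (1 / 2 : ℝ) with hH
  have hHherm : H.IsHermitian := (rpow_nonneg_of_posSemidef _).1
  have hHH : H * H = A := by
    rw [hH, ← CFC.rpow_add hA.isUnit]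
    norm_num
    exact CFC.rpow_one A hA'.nonneg
  have hle : H * Z ^ (p - 1) * H ≤ A ^ p := by
    have h1 := hA.rpow_le_rpow_of_nonpos h (q := p - 1) (by linarith) (by linarith)
    have h2 := star_left_conjugate_le_conjugate h1 H
    rw [show star H = H from hHherm] at h2
    have h3 : H * A ^ (p - 1) * H = A ^ p := by
      rw [hH, ← CFC.rpow_add hA.isUnit, ← CFC.rpow_add hA.isUnit]
      congr 1
      ring
    rwa [h3] at h2
  set a := star U * H * U with ha
  have haherm : a.IsHermitian := by
    have := isHermitian_conjTranspose_mul_mul U hHherm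
    exact this
  have haa : a * a = star U * A * U := by
    rw [ha, ← hHH]
    calc _ = star U * H * (U * star U) * H * U := by simp only [mul_assoc]
      _ = _ := by rw [hUU, mul_one]; simp only [mul_assoc]
  have hada : a * diagonal (fun j => ((hZ.1.eigenvalues j ^ (p - 1) : ℝ) : ℂ)) * a =
      star U * (H * Z ^ (p - 1) * H) * U := by
    rw [hZ.posSemidef.rpow_eq_cfc, hZ.1.cfc_eq_mul, ha]
    simp only [mul_assoc, hU]
  have key := sum_mul_re_sq_diag_le haherm (fun j => hZ.1.eigenvalues j ^ (p - 1)) s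
    (fun i hi j hj => Real.rpow_le_rpow_of_nonpos (hZ.eigenvalues_pos j) (hs i hi j hj)
      (by linarith))
  rw [haa, hada] at key
  exact key.trans (Finset.sum_le_sum fun i _ => re_conj_diag_le hle U i)

/-- The Ando–Zhan inequality for power functions, as a weak majorization. -/
theorem PosDef.weakMaj_rpow_add {A B : Matrix m m ℂ} (hA : A.PosDef) (hB : B.PosDef) {p : ℝ}
    (hp0 : 0 ≤ p) (hp1 : p ≤ 1) (hAB : (A ^ p + B ^ p).IsHermitian) :
    WeakMaj (fun i => (hA.add hB).1.eigenvalues i ^ p) hAB.eigenvalues := by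
  have hZ := hA.add hB
  have hA0 := nonneg_iff_posSemidef.mpr hA.posSemidef
  have hB0 := nonneg_iff_posSemidef.mpr hB.posSemidef
  set U := (hZ.1.eigenvectorUnitary : Matrix m m ℂ)
  refine WeakMaj.trans (b := fun i => ((star U * (A ^ p + B ^ p) * U) i i).re) (fun s => ?_)
    (hAB.weakMaj_diag hZ.1.eigenvectorUnitary)
  obtain ⟨t, ht, htop⟩ := exists_isTopSet hZ.1.eigenvalues s.card_le_univ
  refine ⟨t, ht, ?_⟩
  have htop' : IsTopSet (fun i => hZ.1.eigenvalues i ^ p) t := fun i hi j hj =>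
    Real.rpow_le_rpow (hZ.eigenvalues_pos j).le (htop i hi j hj) hp0
  refine (htop'.sum_le ht.symm).trans ?_
  have h1 := hA.sum_rpow_mul_diag_le hZ (le_add_of_nonneg_right hB0) hp0 hp1 htop
  have h2 := hB.sum_rpow_mul_diag_le hZ (le_add_of_nonneg_left hA0) hp0 hp1 htop
  -- Write `λ^p = λ^(p-1) * λ` and split `λ` into the diagonal entries of `A` and `B` in the
  -- eigenbasis of `A + B`.
  have h3 : ∀ i, hZ.1.eigenvalues i ^ p =
      hZ.1.eigenvalues i ^ (p - 1) * ((star U * A * U) i i).re +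
        hZ.1.eigenvalues i ^ (p - 1) * ((star U * B * U) i i).re := by
    intro i
    have h4 : ((star U * A * U) i i).re + ((star U * B * U) i i).re = hZ.1.eigenvalues i := by
      rw [← Complex.add_re, ← Matrix.add_apply, ← add_mul, ← mul_add, hZ.1.star_mul_mul]
      simp
    rw [← mul_add, h4, ← Real.rpow_add_one (hZ.eigenvalues_pos i).ne', sub_add_cancel]
  simp only [h3]
  rw [Finset.sum_add_distrib]
  refine (add_le_add h1 h2).trans (le_of_eq ?_)
  rw [← Finset.sum_add_distrib]
  refine Finset.sum_congr rfl fun i _ => ?_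
  rw [mul_add, add_mul, Matrix.add_apply, Complex.add_re]

theorem IsHermitian.le_abs {S : Matrix m m ℂ} (hS : S.IsHermitian) : S ≤ CFC.abs S := by
  rw [hS.abs_eq_cfc]
  conv_lhs => rw [← cfc_id ℝ S hS.isSelfAdjoint]
  exact cfc_mono (fun x _ => le_abs_self x) (S.finite_real_spectrum.continuousOn _)
    (S.finite_real_spectrum.continuousOn _)

theorem IsHermitian.neg_abs_le {S : Matrix m m ℂ} (hS : S.IsHermitian) : -CFC.abs S ≤ S := by
  have := hS.neg.le_abs
  rw [CFC.abs_neg] at this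
  exact neg_le.mp this

theorem PosSemidef.rpow_add_smul_one_le {Q : Matrix m m ℂ} (hQ : Q.PosSemidef) {ε p : ℝ}
    (hε : 0 ≤ ε) (hp0 : 0 ≤ p) (hp1 : p ≤ 1) :
    (Q + ε • (1 : Matrix m m ℂ)) ^ p ≤ Q ^ p + ε ^ p • (1 : Matrix m m ℂ) := by
  have hc : ∀ g : ℝ → ℝ, ContinuousOn g (spectrum ℝ Q) := fun g =>
    Q.finite_real_spectrum.continuousOn g
  have hQ' : (Q + ε • (1 : Matrix m m ℂ)).PosSemidef := hQ.add (PosSemidef.one.smul hε)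
  have h1 : Q + ε • (1 : Matrix m m ℂ) = cfc (fun x : ℝ => x + ε) Q := by
    rw [cfc_add_const ε (fun x => x) Q (hc _) hQ.1.isSelfAdjoint, cfc_id' ℝ Q hQ.1.isSelfAdjoint,
      Algebra.algebraMap_eq_smul_one]
  have h2 : Q ^ p + ε ^ p • (1 : Matrix m m ℂ) = cfc (fun x : ℝ => x ^ p + ε ^ p) Q := by
    rw [cfc_add_const (ε ^ p) (fun x => x ^ p) Q (hc _) hQ.1.isSelfAdjoint, ← hQ.rpow_eq_cfc,
      Algebra.algebraMap_eq_smul_one]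
  rw [hQ'.rpow_eq_cfc, h1, h2, ← cfc_comp' (fun x : ℝ => x ^ p) (fun x : ℝ => x + ε) Q
    ((Q.finite_real_spectrum.image _).continuousOn _) (hc _) hQ.1.isSelfAdjoint]
  refine cfc_mono (fun x hx => ?_) (hc _) (hc _)
  exact Real.rpow_add_le_add_rpow
    (spectrum_nonneg_of_nonneg (nonneg_iff_posSemidef.mpr hQ) hx) hε hp0 hp1

/-- In eigenbases the intertwining relation says that the two eigenvalues agree wherever `X i j ≠
0`, which survives applying `f`. -/
theorem cfc_mul_eq_mul_cfc {k : Type*} [Fintype k] [DecidableEq k] {M : Matrix m m ℂ}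
    {A : Matrix k k ℂ} (hM : M.IsHermitian) (hA : A.IsHermitian) {W : Matrix m k ℂ}
    (h : M * W = W * A) (f : ℝ → ℝ) : cfc f M * W = W * cfc f A := by
  set U := (hM.eigenvectorUnitary : Matrix m m ℂ) with hUdef
  set V := (hA.eigenvectorUnitary : Matrix k k ℂ) with hVdef
  have hU : star U * U = 1 := star_mul_self_of_unitary _
  have hU' : U * star U = 1 := self_mul_star_of_unitary _
  have hV : star V * V = 1 := star_mul_self_of_unitary _
  have hV' : V * star V = 1 := self_mul_star_of_unitary _
  have hW : W = U * (star U * W * V) * star V := by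
    calc W = (U * star U) * W * (V * star V) := by rw [hU', hV', Matrix.one_mul, Matrix.mul_one]
      _ = _ := by simp only [Matrix.mul_assoc]
  generalize star U * W * V = X at hW
  subst hW
  have key : ∀ (d : m → ℂ) (e : k → ℂ), diagonal d * X = X * diagonal e ↔
      U * diagonal d * star U * (U * X * star V) = U * X * star V * (V * diagonal e * star V) := by
    intro d e
    have e1 : U * diagonal d * star U * (U * X * star V) = U * (diagonal d * X) * star V := by
      calc _ = U * diagonal d * (star U * U) * X * star V := by simp only [Matrix.mul_assoc]
        _ = _ := by rw [hU, Matrix.mul_one]; simp only [Matrix.mul_assoc]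
    have e2 : U * X * star V * (V * diagonal e * star V) = U * (X * diagonal e) * star V := by
      calc _ = U * X * (star V * V) * diagonal e * star V := by simp only [Matrix.mul_assoc]
        _ = _ := by rw [hV, Matrix.mul_one]; simp only [Matrix.mul_assoc]
    rw [e1, e2]
    refine ⟨fun h => by rw [h], fun h => ?_⟩
    have h' := congrArg (fun Y => star U * Y * V) h
    have e3 : ∀ Y : Matrix m k ℂ, star U * (U * Y * star V) * V = Y := by
      intro Y
      calc _ = (star U * U) * Y * (star V * V) := by simp only [Matrix.mul_assoc]
        _ = Y := by rw [hU, hV, Matrix.one_mul, Matrix.mul_one]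
    simpa only [e3] using h'
  have hd : diagonal (fun i => ((hM.eigenvalues i : ℝ) : ℂ)) * X =
      X * diagonal (fun i => ((hA.eigenvalues i : ℝ) : ℂ)) := by
    rw [key, hUdef, hVdef, ← hM.eq_mul, ← hA.eq_mul]
    exact h
  rw [hM.cfc_eq_mul, hA.cfc_eq_mul, ← key]
  ext i j
  have hij := congrFun (congrFun hd i) j
  rw [diagonal_mul, mul_diagonal, mul_comm] at hij ⊢
  by_cases hX : X i j = 0
  · rw [hX, zero_mul, zero_mul]
  · rw [Complex.ofReal_injective (mul_left_cancel₀ hX hij)]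

end Matrix

/-! ### Norm subadditivity of `|X|^p` on Hermitian matrices. -/

namespace SymmetricNorm

variable {m : Type*} [Fintype m] [DecidableEq m] (N : SymmetricNorm m)

theorem apply_nonneg (X : Matrix m m ℂ) : 0 ≤ N X := NonnegHomClass.apply_nonneg N.toSeminorm X

theorem apply_add_smul_one_le (Y : Matrix m m ℂ) {c : ℝ} (hc : 0 ≤ c) :
    N (Y + c • (1 : Matrix m m ℂ)) ≤ N Y + c * N 1 := by
  refine (map_add_le_add N.toSeminorm _ _).trans (le_of_eq ?_)
  have h := map_smul_eq_mul N.toSeminorm (c : ℂ) (1 : Matrix m m ℂ)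
  rw [Complex.norm_real, Real.norm_of_nonneg hc, Complex.coe_smul] at h
  rw [h]

theorem abs_add_rpow_le_add_smul {S T : Matrix m m ℂ} (hS : S.IsHermitian) (hT : T.IsHermitian)
    {p : ℝ} (hp0 : 0 < p) (hp1 : p ≤ 1) {ε : ℝ} (hε : 0 < ε) :
    N (CFC.abs (S + T) ^ p) ≤
      N (CFC.abs S ^ p + CFC.abs T ^ p) + 2 * ε ^ p * N 1 := by
  have hST := hS.add hT
  have hpos : (ε • (1 : Matrix m m ℂ)).PosDef := Matrix.PosDef.one.smul hε
  have hε1 : (0 : Matrix m m ℂ) ≤ ε • 1 := Matrix.nonneg_iff_posSemidef.mpr hpos.posSemidef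
  have hS0 := Matrix.nonneg_iff_posSemidef.mp (CFC.abs_nonneg S)
  have hT0 := Matrix.nonneg_iff_posSemidef.mp (CFC.abs_nonneg T)
  set A := CFC.abs S + ε • (1 : Matrix m m ℂ)
  set B := CFC.abs T + ε • (1 : Matrix m m ℂ)
  have hA : A.PosDef := Matrix.PosDef.posSemidef_add hS0 hpos
  have hB : B.PosDef := Matrix.PosDef.posSemidef_add hT0 hpos
  have hSA : S ≤ A := hS.le_abs.trans (le_add_of_nonneg_right hε1)
  have hTB : T ≤ B := hT.le_abs.trans (le_add_of_nonneg_right hε1)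
  have hSA' : -A ≤ S := (neg_le_neg (le_add_of_nonneg_right hε1)).trans hS.neg_abs_le
  have hTB' : -B ≤ T := (neg_le_neg (le_add_of_nonneg_right hε1)).trans hT.neg_abs_le
  have hP := hA.add hB
  have h1 : -(A + B) ≤ S + T := by rw [neg_add]; exact add_le_add hSA' hTB'
  have h2 : S + T ≤ A + B := add_le_add hSA hTB
  have hY : (A ^ p + B ^ p).PosSemidef :=
    (Matrix.rpow_nonneg_of_posSemidef p).add (Matrix.rpow_nonneg_of_posSemidef p)
  have hmaj := (weakMaj_rpow_of_prod_le (fun i => abs_nonneg (hST.eigenvalues i))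
    hP.eigenvalues_pos hp0 (hP.exists_prod_abs_eigenvalues_le hST h1 h2)).trans
    (hA.weakMaj_rpow_add hB hp0.le hp1 hY.1)
  calc N (CFC.abs (S + T) ^ p)
      = N.diagSeminorm fun i => |hST.eigenvalues i| ^ p := by
        rw [hST.abs_rpow_eq_cfc, N.apply_cfc hST]
    _ ≤ N.diagSeminorm hY.1.eigenvalues :=
        N.diagSeminorm_mono (fun i => Real.rpow_nonneg (abs_nonneg _) p) hmaj
    _ = N (A ^ p + B ^ p) := (N.apply_isHermitian hY.1).symm
    _ ≤ N (CFC.abs S ^ p + CFC.abs T ^ p + (2 * ε ^ p) • (1 : Matrix m m ℂ)) := by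
        refine N.mono hY ((add_le_add (hS0.rpow_add_smul_one_le hε.le hp0.le hp1)
          (hT0.rpow_add_smul_one_le hε.le hp0.le hp1)).trans (le_of_eq ?_))
        rw [two_mul, add_smul]
        abel
    _ ≤ _ := N.apply_add_smul_one_le _ (by positivity)

/-- Subadditivity of `X ↦ |X| ^ p` on Hermitian matrices, up to symmetric norms. -/
theorem abs_add_rpow_le {S T : Matrix m m ℂ} (hS : S.IsHermitian) (hT : T.IsHermitian)
    {p : ℝ} (hp0 : 0 ≤ p) (hp1 : p ≤ 1) :
    N (CFC.abs (S + T) ^ p) ≤ N (CFC.abs S ^ p + CFC.abs T ^ p) := by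
  rcases hp0.eq_or_lt with rfl | hp0
  · rw [CFC.rpow_zero _ (CFC.abs_nonneg _), CFC.rpow_zero _ (CFC.abs_nonneg _),
      CFC.rpow_zero _ (CFC.abs_nonneg _)]
    exact N.mono Matrix.PosSemidef.one
      (le_add_of_nonneg_right (Matrix.nonneg_iff_posSemidef.mpr Matrix.PosSemidef.one))
  · refine le_of_forall_pos_le_add fun η hη => ?_
    -- Taking `ε = δ^(1/p)` with `δ = η / (2 * N 1 + 1)` makes the error `2 * δ * N 1` at most `η`;
    -- the `+ 1` keeps the denominator positive.
    have hN : 0 < 2 * N 1 + 1 := by have := N.apply_nonneg 1; linarith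
    have hδ : 0 < η / (2 * N 1 + 1) := div_pos hη hN
    have h := N.abs_add_rpow_le_add_smul hS hT hp0 hp1 (Real.rpow_pos_of_pos hδ p⁻¹)
    rw [Real.rpow_inv_rpow hδ.le hp0.ne'] at h
    refine h.trans (add_le_add le_rfl ?_)
    rw [mul_right_comm, mul_div_assoc', div_le_iff₀ hN]
    nlinarith

end SymmetricNorm

/-! ### Absolute values and powers of block matrices. -/

namespace Matrix

variable {n : Type*} [Fintype n] [DecidableEq n]

theorem PosSemidef.fromBlocks_diagonal {A D : Matrix n n ℂ} (hA : A.PosSemidef)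
    (hD : D.PosSemidef) : (fromBlocks A 0 0 D).PosSemidef := by
  obtain ⟨B, rfl⟩ := CStarAlgebra.nonneg_iff_eq_star_mul_self.mp (nonneg_iff_posSemidef.mpr hA)
  obtain ⟨C, rfl⟩ := CStarAlgebra.nonneg_iff_eq_star_mul_self.mp (nonneg_iff_posSemidef.mpr hD)
  have h := posSemidef_conjTranspose_mul_self (fromBlocks B 0 0 C)
  simpa [fromBlocks_conjTranspose, fromBlocks_multiply, star_eq_conjTranspose] using h

theorem cfc_fromBlocks_diagonal {A D : Matrix n n ℂ} (hA : A.IsHermitian) (hD : D.IsHermitian)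
    (f : ℝ → ℝ) : cfc f (fromBlocks A 0 0 D) = fromBlocks (cfc f A) 0 0 (cfc f D) := by
  have hM : (fromBlocks A 0 0 D).IsHermitian := hA.fromBlocks (by simp) hD
  -- The two coordinate embeddings intertwine the block matrix with `A` and `D`, which determines
  -- both block columns.
  have h1 := cfc_mul_eq_mul_cfc hM hA (W := fromRows 1 0) (by
    rw [fromBlocks_mul_fromRows, fromRows_mul]; simp) f
  have h2 := cfc_mul_eq_mul_cfc hM hD (W := fromRows 0 1) (by
    rw [fromBlocks_mul_fromRows, fromRows_mul]; simp) f
  generalize cfc f (fromBlocks A 0 0 D) = X at h1 h2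
  rw [← fromBlocks_toBlocks X, fromBlocks_mul_fromRows, fromRows_mul] at h1 h2
  replace h1 := fromRows_inj h1
  replace h2 := fromRows_inj h2
  simp only [Matrix.mul_one, Matrix.mul_zero, Matrix.zero_mul, Matrix.one_mul, add_zero,
    zero_add] at h1 h2
  rw [← fromBlocks_toBlocks X, h1.1, h1.2, h2.1, h2.2]

theorem PosSemidef.fromBlocks_diagonal_rpow {A D : Matrix n n ℂ} (hA : A.PosSemidef)
    (hD : D.PosSemidef) (p : ℝ) :
    (fromBlocks A 0 0 D) ^ p = fromBlocks (A ^ p) 0 0 (D ^ p) := by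
  rw [(hA.fromBlocks_diagonal hD).rpow_eq_cfc, cfc_fromBlocks_diagonal hA.1 hD.1,
    hA.rpow_eq_cfc, hD.rpow_eq_cfc]

/-- Only `X* X` has to be block diagonal, so uniqueness of the positive square root also covers the
off-diagonal matrix `T`. -/
theorem abs_eq_fromBlocks {X : Matrix (n ⊕ n) (n ⊕ n) ℂ} {A D : Matrix n n ℂ}
    (h : star X * X = fromBlocks (star A * A) 0 0 (star D * D)) :
    CFC.abs X = fromBlocks (CFC.abs A) 0 0 (CFC.abs D) := by
  rw [CFC.abs]
  refine CFC.sqrt_unique ?_ (nonneg_iff_posSemidef.mpr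
    ((nonneg_iff_posSemidef.mp (CFC.abs_nonneg A)).fromBlocks_diagonal
      (nonneg_iff_posSemidef.mp (CFC.abs_nonneg D))))
  rw [h, fromBlocks_multiply]
  simp [CFC.abs_mul_abs]

theorem abs_rpow_eq_fromBlocks {X : Matrix (n ⊕ n) (n ⊕ n) ℂ} {A D : Matrix n n ℂ}
    (h : star X * X = fromBlocks (star A * A) 0 0 (star D * D)) (p : ℝ) :
    CFC.abs X ^ p = fromBlocks (CFC.abs A ^ p) 0 0 (CFC.abs D ^ p) := by
  rw [abs_eq_fromBlocks h, PosSemidef.fromBlocks_diagonal_rpow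
    (nonneg_iff_posSemidef.mp (CFC.abs_nonneg A)) (nonneg_iff_posSemidef.mp (CFC.abs_nonneg D))]

end Matrix

/-! ### Pinching and the passage to the corner norm. -/

namespace SymmetricNorm

open Matrix

variable {n : Type*} [Fintype n] [DecidableEq n] (N : SymmetricNorm (n ⊕ n))

/-- The diagonal part is the average of the matrix and its conjugate by the unitary `1 ⊕ (-1)`. -/
theorem fromBlocks_diagonal_le (A B C D : Matrix n n ℂ) :
    N (fromBlocks A 0 0 D) ≤ N (fromBlocks A B C D) := by
  have hJ : fromBlocks (1 : Matrix n n ℂ) 0 0 (-1 : Matrix n n ℂ) ∈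
      Matrix.unitaryGroup (n ⊕ n) ℂ := by
    rw [Matrix.mem_unitaryGroup_iff, star_eq_conjTranspose]
    simp [fromBlocks_conjTranspose, fromBlocks_multiply]
  have h1 : N (fromBlocks A (-B) (-C) D) = N (fromBlocks A B C D) := by
    rw [← N.apply_unitary_mul_mul ⟨_, hJ⟩ ⟨_, hJ⟩ (fromBlocks A B C D)]
    simp [fromBlocks_multiply]
  have h2 : (2 : ℂ) • fromBlocks A 0 0 D = fromBlocks A B C D + fromBlocks A (-B) (-C) D := by
    rw [fromBlocks_add, fromBlocks_smul]
    simp [two_smul]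
  have h3 := map_smul_eq_mul N.toSeminorm (2 : ℂ) (fromBlocks A 0 0 D)
  have h4 := map_add_le_add N.toSeminorm (fromBlocks A B C D) (fromBlocks A (-B) (-C) D)
  rw [← h2, h3, h1] at h4
  simp only [Complex.norm_ofNat] at h4
  linarith

/-- For the block column `R` of `√A` and `√D`, `R R*` has diagonal blocks `A`, `D`, while `R* R = (A
+ D) ⊕ 0` has the same characteristic polynomial, hence the same norm. -/
theorem fromBlocks_diagonal_le_corner_add {A D : Matrix n n ℂ} (hA : A.PosSemidef)
    (hD : D.PosSemidef) : N (fromBlocks A 0 0 D) ≤ N.corner (A + D) := by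
  have hA0 := nonneg_iff_posSemidef.mpr hA
  have hD0 := nonneg_iff_posSemidef.mpr hD
  set B := CFC.sqrt A
  set C := CFC.sqrt D
  have hB : Bᴴ = B := (nonneg_iff_posSemidef.mp (CFC.sqrt_nonneg A)).1
  have hC : Cᴴ = C := (nonneg_iff_posSemidef.mp (CFC.sqrt_nonneg D)).1
  have hBB : B * B = A := CFC.sqrt_mul_sqrt_self A hA0
  have hCC : C * C = D := CFC.sqrt_mul_sqrt_self D hD0
  let R : Matrix (n ⊕ n) (n ⊕ n) ℂ := fromBlocks B 0 C 0
  have h1 : R * Rᴴ = fromBlocks A (B * C) (C * B) D := by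
    simp [R, fromBlocks_conjTranspose, fromBlocks_multiply, hB, hC, hBB, hCC]
  have h2 : Rᴴ * R = fromBlocks (A + D) 0 0 0 := by
    simp [R, fromBlocks_conjTranspose, fromBlocks_multiply, hB, hC, hBB, hCC]
  refine (N.fromBlocks_diagonal_le A (B * C) (C * B) D).trans (le_of_eq ?_)
  change _ = N (fromBlocks (A + D) 0 0 0)
  rw [← h1, ← h2]
  exact N.apply_eq_of_charpoly_eq (isHermitian_mul_conjTranspose_self R)
    (isHermitian_conjTranspose_mul_self R) (charpoly_mul_comm R Rᴴ)

end SymmetricNorm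

/-! ### Assembly of the block inequality. -/

theorem corollary2p6 {n : Type*} [Fintype n] [DecidableEq n]
    (A B C : Matrix n n ℂ) (hM : (Matrix.fromBlocks A Bᴴ B C).IsHermitian)
    (N : SymmetricNorm (n ⊕ n)) (p : ℝ) (hp0 : 0 ≤ p) (hp1 : p ≤ 1) :
    N (CFC.abs (Matrix.fromBlocks A Bᴴ B C) ^ p) ≤
      N.corner (CFC.abs A ^ p + CFC.abs B ^ p + CFC.abs Bᴴ ^ p + CFC.abs C ^ p) := by
  obtain ⟨hA, -, -, hC⟩ := Matrix.isHermitian_fromBlocks_iff.mp hM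
  have hS : (Matrix.fromBlocks A 0 0 C).IsHermitian := Matrix.IsHermitian.fromBlocks hA (by simp) hC
  have hT : (Matrix.fromBlocks 0 Bᴴ B 0).IsHermitian :=
    Matrix.IsHermitian.fromBlocks Matrix.isHermitian_zero (by simp) Matrix.isHermitian_zero
  have hsum : Matrix.fromBlocks A Bᴴ B C =
      Matrix.fromBlocks A 0 0 C + Matrix.fromBlocks 0 Bᴴ B 0 := by
    simp [Matrix.fromBlocks_add]
  have hSabs : CFC.abs (Matrix.fromBlocks A 0 0 C) ^ p =
      Matrix.fromBlocks (CFC.abs A ^ p) 0 0 (CFC.abs C ^ p) :=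
    Matrix.abs_rpow_eq_fromBlocks (by
      simp [Matrix.star_eq_conjTranspose, Matrix.fromBlocks_conjTranspose,
        Matrix.fromBlocks_multiply]) p
  -- Here `T* T = B* B ⊕ B B*`, so `|B|` sits in the first block and `|B*|` in the second.
  have hTabs : CFC.abs (Matrix.fromBlocks 0 Bᴴ B 0) ^ p =
      Matrix.fromBlocks (CFC.abs B ^ p) 0 0 (CFC.abs Bᴴ ^ p) :=
    Matrix.abs_rpow_eq_fromBlocks (by
      simp [Matrix.star_eq_conjTranspose, Matrix.fromBlocks_conjTranspose,
        Matrix.fromBlocks_multiply]) p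
  have hpos : ∀ X : Matrix n n ℂ, (X ^ p).PosSemidef := fun X =>
    Matrix.rpow_nonneg_of_posSemidef p
  rw [hsum]
  refine (N.abs_add_rpow_le hS hT hp0 hp1).trans ?_
  rw [hSabs, hTabs, Matrix.fromBlocks_add, add_zero]
  refine (N.fromBlocks_diagonal_le_corner_add ((hpos _).add (hpos _))
    ((hpos _).add (hpos _))).trans (le_of_eq ?_)
  congr 1
  abel
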